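/- **Signal-passing tile assembly (STAM).** An active tile is a non-rotatable unit square each of whose four sides $d$ carries a set of glues of pairwise distinct types $g\in\Gamma$, each in one of the states latent, on, off. The tile also has labels with states (which play no role in binding), a transition function $\delta$ assigning to every pair (side, glue type) a finite set of actions, each of the form "turn the glue $g'$ on side $d'$ on (or off)" or "turn a label on (or off)", and a multiset $\Pi$ of pending actions. A supertile is a placement, up to translation, of finitely many active tiles on $\mathbb Z^2$. Two glues of the same type, both on, lying on abutting sides of adjacent tiles, bind. At the moment of binding each of them fires: the actions $\delta(d,g)$ are added to $\Pi$ of its own tile. Every glue type has a strength. A supertile is $\tau$-stable if each cut of its bond graph has total strength at least $\tau$. A system $(T,\tau)$ consists of a finite set $T$ of active tiles with $\Pi=\emptyset$ and all glues latent or on, and a temperature $\tau\ge 1$. Its producible supertiles are the single tiles of $T$ and everything obtained from producible supertiles by the following transitions: two $\tau$-stable supertiles, translated so as not to overlap, combine if the matching on glues along their common boundary have total strength at least $\tau$ (all of these glues then bind); a supertile breaks into two parts along a cut of strength less than $\tau$; one pending action of one tile is removed from $\Pi$ and executed, where only the changes latent $\to$ on, latent $\to$ off and on $\to$ off have an effect.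 A producible supertile is terminal if no transition applies to it. The system uniquely assembles a shape $X\subseteq\mathbb Z^2$ if terminal supertiles exist, each of them occupies exactly a translate of $X$, and every producible supertile can be transformed into a terminal one by a finite sequence of transitions. **Theorem.** For every integer $n\ge 1$ there is a temperature-1 STAM system $(T_n,1)$, all of whose glues have strength 1, that uniquely assembles the $n\times 1$ line. Moreover $T_n$ consists of exactly 4 active tile types, every tile of $T_n$ carries (over its four sides together) $O(\log n)$ glues as $n\to\infty$, and no glue deactivation is used: no transition function of a tile of $T_n$ ever requests that a glue be turned off. -/

import Mathlib

namespace STAM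

/-! Signal-passing tile assembly model with singleton initial tiles. -/

/-- The four sides of a unit square tile. -/
inductive Dir
  | north
  | south
  | east
  | west
  deriving DecidableEq

instance : Fintype Dir where
  elems := {Dir.north, Dir.south, Dir.east, Dir.west}
  complete := fun d => by cases d <;> simp

/-- The side of the neighbouring tile that abuts a given side. -/
def Dir.opp : Dir → Dir
  | .north => .south
  | .south => .north
  | .east => .west
  | .west => .east

/-- The unit vector of a side. -/
def Dir.vec : Dir → ℤ × ℤ
  | .north => (0, 1)
  | .south => (0, -1)
  | .east => (1, 0)
  | .west => (-1, 0)

/-- The states of an active glue or an active label. -/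
inductive State
  | latent
  | on
  | off
  deriving DecidableEq

/-- The target state of an action. -/
inductive Switch
  | on
  | off
  deriving DecidableEq

/-- The effect of executing an action: only `latent → on`, `latent → off` and `on → off` change
the state, every other request is void. -/
def State.next : State → Switch → State
  | .latent, .on => .on
  | .latent, .off => .off
  | .on, .off => .off
  | p, _ => p

/-- Glue actions and label actions, over glue types `Γ` and labels `Λ`. -/
inductive Action (Γ Λ : Type)
  | glue (d : Dir) (g : Γ) (q : Switch)
  | label (x : Λ) (q : Switch)

/-- An active tile `(G, L, δ, Π)`. Each side carries at most one copy of each glue type, so `G d` is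
the partial function that sends the glue types present on side `d` to their states; likewise `L` for
the labels. The transition function `δ d g` is the set of actions requested when glue `g` on
side `d` binds, and `pending` is the multiset `Π` of actions requested but not yet executed. -/
@[ext]
structure ActiveTile (Γ Λ : Type) where
  G : Dir → Γ → Option State
  L : Λ → Option State
  δ : Dir → Γ → Finset (Action Γ Λ)
  pending : Multiset (Action Γ Λ)

/-- A placement of active tiles on the square lattice; `none` is an empty position. -/
abbrev Assembly (Γ Λ : Type) := ℤ × ℤ → Option (ActiveTile Γ Λ)

variable {Γ Λ : Type}

/-- The number of glues on a tile, counted over all four sides. -/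
def ActiveTile.glueCount [Fintype Γ] (t : ActiveTile Γ Λ) : ℕ :=
  ((Finset.univ : Finset (Dir × Γ)).filter fun x => (t.G x.1 x.2).isSome = true).card

/-- No binding event on the tile ever requests that a glue be turned off. -/
def ActiveTile.NoGlueDeactivation (t : ActiveTile Γ Λ) : Prop :=
  ∀ (d : Dir) (g : Γ) (d' : Dir) (g' : Γ), Action.glue d' g' Switch.off ∉ t.δ d g

/-- The glues in `X` bind: each of them fires the transition function once. -/
def ActiveTile.fire (t : ActiveTile Γ Λ) (X : Finset (Dir × Γ)) : ActiveTile Γ Λ :=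
  { t with pending := t.pending + ∑ x ∈ X, (t.δ x.1 x.2).val }

namespace Assembly

/-- The assembly consisting of the single tile `t`, at the origin. -/
def single (t : ActiveTile Γ Λ) : Assembly Γ Λ :=
  fun p => if p = 0 then some t else none

/-- The translate of `A` by `v`. -/
def shift (v : ℤ × ℤ) (A : Assembly Γ Λ) : Assembly Γ Λ :=
  fun p => A (p - v)

/-- The joint placement of two non-overlapping assemblies. -/
def union (A B : Assembly Γ Λ) : Assembly Γ Λ :=
  fun p => (A p).or (B p)

/-- The part of `A` on the positions of `s`. -/
def inside (A : Assembly Γ Λ) (s : Finset (ℤ × ℤ)) : Assembly Γ Λ :=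
  fun p => if p ∈ s then A p else none

/-- The part of `A` off the positions of `s`. -/
def outside (A : Assembly Γ Λ) (s : Finset (ℤ × ℤ)) : Assembly Γ Λ :=
  fun p => if p ∈ s then none else A p

/-- The tile of `A` at position `p` has glue `g` on side `d`, in the state `on`. -/
def GlueOn (A : Assembly Γ Λ) (p : ℤ × ℤ) (d : Dir) (g : Γ) : Prop :=
  ((A p).bind fun t => t.G d g) = some State.on

instance (A : Assembly Γ Λ) (p : ℤ × ℤ) (d : Dir) (g : Γ) : Decidable (A.GlueOn p d g) :=
  inferInstanceAs (Decidable (((A p).bind fun t => t.G d g) = some State.on))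

variable [Fintype Γ] [DecidableEq Γ]

/-- The glues (with their sides) of the tile of `A` at `p` that are bound: they are `on` and so is
the glue of the same type on the abutting side of the adjacent tile. -/
def bonds (A : Assembly Γ Λ) (p : ℤ × ℤ) : Finset (Dir × Γ) :=
  Finset.univ.filter fun x => A.GlueOn p x.1 x.2 ∧ A.GlueOn (p + x.1.vec) x.1.opp x.2

/-- Every glue that is bound in `A` and does not belong to `old` fires the transition function
of its tile. -/
def fireNew (old : ℤ × ℤ → Finset (Dir × Γ)) (A : Assembly Γ Λ) : Assembly Γ Λ :=
  fun p => (A p).map fun t => t.fire (A.bonds p \ old p)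

/-- The total strength of the bonds of `A` between a position in `s` and a position outside `s`. -/
def cutStrength (strength : Γ → ℤ) (A : Assembly Γ Λ) (s : Finset (ℤ × ℤ)) : ℤ :=
  ∑ p ∈ s, ∑ x ∈ (A.bonds p).filter (fun x => p + x.1.vec ∉ s), strength x.2

/-- The set `s` separates the tiles of `A` into two nonempty parts. -/
def IsCut (A : Assembly Γ Λ) (s : Finset (ℤ × ℤ)) : Prop :=
  (∃ p, p ∈ s ∧ A p ≠ none) ∧ ∃ p, p ∉ s ∧ A p ≠ none

/-- `A` is `τ`-stable: every cut of its binding graph has strength at least `τ`. -/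
def Stable (strength : Γ → ℤ) (τ : ℕ) (A : Assembly Γ Λ) : Prop :=
  ∀ s : Finset (ℤ × ℤ), A.IsCut s → (τ : ℤ) ≤ A.cutStrength strength s

/-- `A` and `B`, as placed, combine into `C`: they are `τ`-stable and do not overlap, the matched
`on` glues along their boundary have total strength at least `τ`, and in `C` all these glues have
bound, thereby firing the transition functions of their tiles. -/
structure CombinesInto (strength : Γ → ℤ) (τ : ℕ) (A B C : Assembly Γ Λ) : Prop where
  stable_left : A.Stable strength τ
  stable_right : B.Stable strength τ
  disjoint : ∀ p, A p = none ∨ B p = none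
  binds : ∃ s : Finset (ℤ × ℤ), (∀ p, p ∈ s ↔ A p ≠ none) ∧
    (τ : ℤ) ≤ (A.union B).cutStrength strength s
  result : C = (A.union B).fireNew fun p => A.bonds p ∪ B.bonds p

/-- `A` breaks into `B` and `C` along a cut of strength less than `τ`. -/
def BreaksInto (strength : Γ → ℤ) (τ : ℕ) (A B C : Assembly Γ Λ) : Prop :=
  ∃ s : Finset (ℤ × ℤ), A.IsCut s ∧ A.cutStrength strength s < (τ : ℤ) ∧
    ((B = A.inside s ∧ C = A.outside s) ∨ (B = A.outside s ∧ C = A.inside s))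

/-- One pending glue action of one tile of `A` is executed. A glue that this turns `on` next to a
matching `on` glue binds, which fires the transition functions of both tiles. -/
def GlueTransition (A B : Assembly Γ Λ) : Prop :=
  ∃ (p : ℤ × ℤ) (t : ActiveTile Γ Λ) (d : Dir) (g : Γ) (s : State) (q : Switch)
    (P : Multiset (Action Γ Λ)),
    A p = some t ∧ t.G d g = some s ∧ t.pending = Action.glue d g q ::ₘ P ∧
    B = fireNew A.bonds (Function.update A p (some
      { t with
        G := Function.update t.G d (Function.update (t.G d) g (some (s.next q)))
        pending := P }))

/-- One pending label action of one tile of `A` is executed. -/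
def LabelTransition (A B : Assembly Γ Λ) : Prop :=
  ∃ (p : ℤ × ℤ) (t : ActiveTile Γ Λ) (x : Λ) (s : State) (q : Switch)
    (P : Multiset (Action Γ Λ)) (L' : Λ → Option State),
    A p = some t ∧ t.L x = some s ∧ t.pending = Action.label x q ::ₘ P ∧
    L' x = some (s.next q) ∧ (∀ y, y ≠ x → L' y = t.L y) ∧
    B = Function.update A p (some { t with L := L', pending := P })

/-- The positions occupied by `A` form a translate of `X`. -/
def HasShape (A : Assembly Γ Λ) (X : Set (ℤ × ℤ)) : Prop :=
  ∃ v : ℤ × ℤ, ∀ p, A p ≠ none ↔ p - v ∈ X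

end Assembly

/-- An STAM system whose initial supertiles are single active tiles. Initially no action is
pending and every glue is `latent` or `on`. -/
structure System (Γ Λ : Type) where
  strength : Γ → ℤ
  tiles : Set (ActiveTile Γ Λ)
  temperature : ℕ
  tiles_finite : tiles.Finite
  temperature_pos : 0 < temperature
  pending_eq : ∀ t ∈ tiles, t.pending = 0
  glue_ne_off : ∀ t ∈ tiles, ∀ d g, t.G d g ≠ some State.off

namespace System

variable [Fintype Γ] [DecidableEq Γ]

/-- The producible supertiles, each up to translation. -/
inductive Producible (S : System Γ Λ) : Assembly Γ Λ → Prop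
  | initial (t : ActiveTile Γ Λ) (ht : t ∈ S.tiles) : Producible S (Assembly.single t)
  | combine (A B C : Assembly Γ Λ) (v : ℤ × ℤ) (hA : Producible S A) (hB : Producible S B)
      (h : A.CombinesInto S.strength S.temperature (B.shift v) C) : Producible S C
  | break_ (A B C : Assembly Γ Λ) (hA : Producible S A)
      (h : A.BreaksInto S.strength S.temperature B C) : Producible S B
  | glue (A B : Assembly Γ Λ) (hA : Producible S A) (h : A.GlueTransition B) : Producible S B
  | label (A B : Assembly Γ Λ) (hA : Producible S A) (h : A.LabelTransition B) : Producible S B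

/-- One transition that `A` can undergo in the system, into `C`. -/
inductive Step (S : System Γ Λ) (A C : Assembly Γ Λ) : Prop
  | combine (B : Assembly Γ Λ) (v : ℤ × ℤ) (hB : S.Producible B)
      (h : A.CombinesInto S.strength S.temperature (B.shift v) C)
  | break_ (B : Assembly Γ Λ) (h : A.BreaksInto S.strength S.temperature C B)
  | glue (h : A.GlueTransition C)
  | label (h : A.LabelTransition C)

/-- Terminal supertiles: producible, with no possible combination, break, glue transition or
label transition. -/
def Terminal (S : System Γ Λ) (A : Assembly Γ Λ) : Prop :=
  S.Producible A ∧ ∀ C, ¬ S.Step A C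

/-- The system uniquely assembles the shape `X`: terminal supertiles exist and all of them have the
shape `X`, and every producible supertile can be transformed into a terminal one. -/
def UniquelyAssembles (S : System Γ Λ) (X : Set (ℤ × ℤ)) : Prop :=
  (∃ A, S.Terminal A) ∧ (∀ A, S.Terminal A → A.HasShape X) ∧
    ∀ A, S.Producible A → ∃ B, S.Terminal B ∧ Relation.ReflTransGen S.Step A B

end System

/-- The `n × 1` line: `n` consecutive positions in one row. -/
def line (n : ℕ) : Set (ℤ × ℤ) :=
  {p | 0 ≤ p.1 ∧ p.1 < (n : ℤ) ∧ p.2 = 0}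

end STAM

namespace STAM

/-! The line carries a binary counter: tile `j` holds `n - 1 - j`, and a new tile starts blank and
learns its value from its western neighbour through bindings alone. For each bit `i` a tile offers
on its east side the glues `(i, b, c)` with `b` its own bit and `c` free; the next tile offers on
its west side those with `c` the borrow into bit `i` and `b` free. Exactly one of these glues is on
both sides, and its binding tells the eastern tile the pair `(b, c)`. This yields its own bit `xor b
c`, the borrow `c && !b` into the next bit and, if its own bit is 1, the fact that its counter is
nonzero, upon which it turns on the glue attaching a further tile. Every signal states a final
truth, so none needs to be retracted and no glue is turned off.

Soundness: `Legit` lists the glues allowed to be on, and `Trig.legit` shows that signals respect it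
in any order of execution. Hence a producible supertile is a lone filler or a line of at most `n`
tiles (`supertileInv_of_producible`). Completeness: `LineInv.fired` records that each request of a
bound glue is pending or fulfilled; with nothing pending, `LineInv.glueOn_east` shows that all
legitimate east glues are on, so a line shorter than `n` can still grow. Termination is
lexicographic in missing tiles, latent glues and pending actions (`LineInv.exists_terminal`).

The three fillers differ only in an inert label, which brings the number of tile types to four. -/

/-- The glue types of the line system. `none` attaches a new tile; `some (i, b, c)` says that
bit `i` of the counter of the western tile is `b`, and that the borrow into bit `i` when this counter
is decremented is `c`. -/
abbrev LineGlue (m : ℕ) : Type := Option (Fin m × Bool × Bool)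

/-- The tiles of the line system; the single label is the colour of the tile. -/
abbrev LineTile (m : ℕ) : Type := ActiveTile (LineGlue m) Unit

/-- `Trig x y`: when the glue `x` binds, the glue `y` of the same tile is asked to turn on. -/
inductive Trig {m : ℕ} : Dir × LineGlue m → Dir × LineGlue m → Prop
  | start (i : Fin m) (b : Bool) (hi : i.val = 0) : Trig (.west, none) (.west, some (i, b, true))
  | bit (i : Fin m) (b c c' : Bool) : Trig (.west, some (i, b, c)) (.east, some (i, xor b c, c'))
  | borrow (i i' : Fin m) (b c b' : Bool) (hi : i'.val = i.val + 1) :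
      Trig (.west, some (i, b, c)) (.west, some (i', b', c && !b))
  | attach (i : Fin m) (b c : Bool) (h : xor b c = true) :
      Trig (.west, some (i, b, c)) (.east, none)

/-- The request to turn a glue on. -/
def turnOn (m : ℕ) : Dir × LineGlue m ↪ Action (LineGlue m) Unit where
  toFun y := .glue y.1 y.2 .on
  inj' := by
    rintro ⟨d, g⟩ ⟨d', g'⟩ h
    simpa using h

open Classical in
/-- The common transition function of all tiles of the line system. -/
noncomputable def lineδ (m : ℕ) (d : Dir) (g : LineGlue m) : Finset (Action (LineGlue m) Unit) :=
  (Finset.univ.filter fun y => Trig (d, g) y).map (turnOn m)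

lemma mem_lineδ {m : ℕ} {x : Dir × LineGlue m} {a : Action (LineGlue m) Unit} :
    a ∈ lineδ m x.1 x.2 ↔ ∃ y, Trig x y ∧ a = turnOn m y := by
  simp only [lineδ, Finset.mem_map, Finset.mem_filter, Finset.mem_univ, true_and]
  exact ⟨fun ⟨y, h, e⟩ => ⟨y, h, e.symm⟩, fun ⟨y, h, e⟩ => ⟨y, h, e.symm⟩⟩

/-- The glues that may ever be on at the tile number `j` of the line of length `n`, whose counter
is `n - 1 - j`. -/
def Legit (n j : ℕ) {m : ℕ} : Dir × LineGlue m → Prop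
  | (.east, none) => j + 1 < n
  | (.east, some (i, b, _)) => b = (n - 1 - j).testBit i
  | (.west, none) => 0 < j
  | (.west, some (i, _, c)) => 0 < j ∧ c = decide ((n - j) % 2 ^ i.val = 0)
  | _ => False

/-! ### Decrementing in binary, and soundness of the signals -/

/-- A borrow reaches bit `i` exactly when all lower bits of `v` vanish, and then it flips the bit.
In terms of quotients: `w / 2 ^ i` and `(w + 1) / 2 ^ i` differ, by one, just when `2 ^ i` divides
`w + 1`. -/
lemma testBit_pred (v i : ℕ) (hv : 0 < v) :
    (v - 1).testBit i = xor (v.testBit i) (decide (v % 2 ^ i = 0)) := by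
  obtain ⟨w, rfl⟩ : ∃ w, v = w + 1 := ⟨v - 1, by omega⟩
  simp only [Nat.add_sub_cancel, Nat.testBit_eq_decide_div_mod_eq, Nat.succ_div,
    Nat.dvd_iff_mod_eq_zero]
  rcases Nat.mod_two_eq_zero_or_one (w / 2 ^ i) with h | h <;>
    by_cases h' : (w + 1) % 2 ^ i = 0 <;> simp only [h', if_true, if_false] <;>
    simp [h, Nat.add_mod (w / 2 ^ i)]

/-- A borrow passes on through bit `i` iff it arrives there and finds a 0; this is the rule of
`Trig.borrow`. -/
lemma mod_two_pow_succ_eq_zero (v i : ℕ) :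
    decide (v % 2 ^ (i + 1) = 0) = (decide (v % 2 ^ i = 0) && !v.testBit i) := by
  rw [Nat.mod_pow_succ, Nat.testBit_eq_decide_div_mod_eq]
  rcases Nat.mod_two_eq_zero_or_one (v / 2 ^ i) with h | h <;>
    by_cases h' : v % 2 ^ i = 0 <;> simp [h, h']

lemma Trig.fst {m : ℕ} {x y : Dir × LineGlue m} (h : Trig x y) : x.1 = .west := by
  cases h <;> rfl

/-- The east side vouches for `b` and the west side for `c`, so a glue legitimate on both carries
the true bit and borrow of `n - (j + 1)`; each signal is then a rule of binary subtraction. -/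
lemma Trig.legit {n j m : ℕ} {g : LineGlue m} {y : Dir × LineGlue m} (hj : j + 1 < n)
    (hw : Legit n (j + 1) (.west, g)) (he : Legit n j (.east, g)) (h : Trig (.west, g) y) :
    Legit n (j + 1) y := by
  have e : n - 1 - j = n - (j + 1) := by omega
  have e' : n - 1 - (j + 1) = n - (j + 1) - 1 := by omega
  cases h with
  | start i b hi => simp [Legit, hi, Nat.mod_one]
  | bit i b c c' =>
    simp only [Legit] at hw he ⊢
    rw [e', testBit_pred _ _ (by omega), ← hw.2, he, e]
  | borrow i i' b c b' hi =>
    simp only [Legit] at hw he ⊢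
    refine ⟨hw.1, ?_⟩
    rw [hi, mod_two_pow_succ_eq_zero, ← hw.2, he, e]
  | attach i b c hx =>
    simp only [Legit] at hw he ⊢
    rw [he, e, hw.2, ← testBit_pred _ _ (by omega)] at hx
    -- The last tile has counter 0, so none of its bits can request an attachment.
    by_contra hn
    have : n - (j + 1) - 1 = 0 := by omega
    simp [this] at hx

/-! ### The tiles and the system -/

open Classical in
/-- The seed tile, holding the counter `n - 1`. -/
noncomputable def seed (n m : ℕ) : LineTile m where
  G d g := if d = .east then some (if Legit n 0 (d, g) then .on else .latent) else none
  L _ := none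
  δ := lineδ m
  pending := 0

/-- The filler tile of colour `σ`. -/
noncomputable def filler (m : ℕ) (σ : State) : LineTile m where
  G d g := if d = .east then some .latent
    else if d = .west then some (if g = none then .on else .latent) else none
  L _ := some σ
  δ := lineδ m
  pending := 0

/-- The system assembling the `n × 1` line. -/
noncomputable def lineSystem (n m : ℕ) : System (LineGlue m) Unit where
  strength _ := 1
  tiles := insert (seed n m) (Set.range (filler m))
  temperature := 1
  tiles_finite := by
    refine Set.Finite.insert _ ?_
    have : Set.range (filler m) ⊆ {filler m .latent, filler m .on, filler m .off} := by
      rintro _ ⟨σ, rfl⟩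
      cases σ <;> simp
    exact Set.Finite.subset (by simp) this
  temperature_pos := one_pos
  pending_eq := by
    rintro t (rfl | ⟨σ, rfl⟩) <;> rfl
  glue_ne_off := by
    rintro t (rfl | ⟨σ, rfl⟩) d g <;> simp only [seed, filler] <;> split_ifs <;> simp

lemma filler_injective (m : ℕ) : Function.Injective (filler m) := by
  intro σ σ' h
  have := congrFun (congrArg ActiveTile.L h) ()
  simpa [filler] using this

lemma seed_ne_filler (n m : ℕ) (σ : State) : seed n m ≠ filler m σ := by
  intro h
  have := congrFun (congrArg ActiveTile.L h) ()
  simp [filler, seed] at this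

/-- The label alone tells the tiles apart: three colours, and no label on the seed. -/
lemma lineSystem_ncard (n m : ℕ) : (lineSystem n m).tiles.ncard = 4 := by
  have e : (lineSystem n m).tiles
      = ↑({seed n m} : Set _) ∪ {filler m .latent, filler m .on, filler m .off} := by
    ext t
    simp only [lineSystem, Set.mem_insert_iff, Set.mem_range, Set.mem_union, Set.mem_singleton_iff]
    refine or_congr_right ⟨?_, ?_⟩
    · rintro ⟨σ, rfl⟩
      cases σ <;> simp
    · rintro (h | h | h) <;> exact ⟨_, h.symm⟩
  rw [e, Set.ncard_union_eq (by simp [seed_ne_filler])]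
  rw [Set.ncard_singleton, Set.ncard_insert_of_notMem, Set.ncard_pair] <;>
  simp [(filler_injective m).eq_iff]

lemma lineSystem_δ {n m : ℕ} {t : LineTile m} (ht : t ∈ (lineSystem n m).tiles) : t.δ = lineδ m := by
  rcases ht with rfl | ⟨σ, rfl⟩ <;> rfl

lemma lineSystem_noGlueDeactivation {n m : ℕ} {t : LineTile m}
    (ht : t ∈ (lineSystem n m).tiles) : t.NoGlueDeactivation := by
  intro d g d' g' h
  rw [lineSystem_δ ht] at h
  obtain ⟨y, -, e⟩ := (mem_lineδ (x := (d, g))).1 h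
  cases e

lemma glueCount_le {m : ℕ} (t : LineTile m) : t.glueCount ≤ 4 * (4 * m + 1) := by
  refine (Finset.card_le_univ _).trans (le_of_eq ?_)
  have : Fintype.card Dir = 4 := rfl
  simp only [Fintype.card_prod, Fintype.card_option, Fintype.card_fin, Fintype.card_bool, this]
  ring

/-! ### The invariant of a tile -/

/-- The invariant of the tile number `j` of a growing line. -/
structure TileInv (n j : ℕ) {m : ℕ} (t : LineTile m) : Prop where
  delta : t.δ = lineδ m
  state : ∀ x, Legit n j x → t.G x.1 x.2 = some .latent ∨ t.G x.1 x.2 = some .on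
  sound : ∀ x, t.G x.1 x.2 = some .on → Legit n j x
  seed_on : j = 0 → ∀ x, Legit n j x → t.G x.1 x.2 = some .on
  west_on : 0 < j → t.G .west none = some .on
  pend : ∀ a ∈ t.pending, ∃ x, a = turnOn m x ∧ Legit n j x

lemma tileInv_seed (n m : ℕ) : TileInv n 0 (seed n m) := by
  have h0 : ∀ x, Legit n 0 x → (seed n m).G x.1 x.2 = some .on := by
    rintro ⟨d, _ | ⟨i, b, c⟩⟩ h <;> cases d <;> simp_all [seed, Legit]
  refine ⟨rfl, fun x hx => .inr (h0 x hx), ?_, fun _ => h0, by simp, by simp [seed]⟩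
  rintro ⟨d, g⟩ h
  simp only [seed] at h
  split_ifs at h with _ hl
  · exact hl
  · simp at h

lemma tileInv_filler (n m : ℕ) {j : ℕ} (σ : State) (hj : 0 < j) : TileInv n j (filler m σ) := by
  refine ⟨rfl, ?_, ?_, by omega, by simp [filler], by simp [filler]⟩
  · rintro ⟨d, _ | ⟨i, b, c⟩⟩ h <;> cases d <;> simp_all [filler, Legit]
  · rintro ⟨d, _ | ⟨i, b, c⟩⟩ h <;> cases d <;> simp_all [filler, Legit]

lemma TileInv.fire {n j m : ℕ} {t : LineTile m} (h : TileInv n j t) {X : Finset (Dir × LineGlue m)}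
    (hX : ∀ x ∈ X, ∀ y, Trig x y → Legit n j y) : TileInv n j (t.fire X) := by
  refine ⟨h.delta, h.state, h.sound, h.seed_on, h.west_on, fun a ha => ?_⟩
  rcases Multiset.mem_add.1 ha with ha | ha
  · exact h.pend a ha
  · obtain ⟨x, hx, ha⟩ := Multiset.mem_sum.1 ha
    rw [h.delta] at ha
    obtain ⟨y, hy, e⟩ := mem_lineδ.1 ha
    exact ⟨y, e, hX x hx y hy⟩

/-- The tile after the glue `g` on side `d` is turned on, with pending actions `P`. -/
def ActiveTile.execOn {m : ℕ} (t : LineTile m) (d : Dir) (g : LineGlue m)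
    (P : Multiset (Action (LineGlue m) Unit)) : LineTile m :=
  { t with
    G := Function.update t.G d (Function.update (t.G d) g (some .on))
    pending := P }

lemma execOn_G {m : ℕ} (t : LineTile m) (d : Dir) (g : LineGlue m)
    (P : Multiset (Action (LineGlue m) Unit)) (x : Dir × LineGlue m) :
    (t.execOn d g P).G x.1 x.2 = if x = (d, g) then some .on else t.G x.1 x.2 := by
  obtain ⟨d', g'⟩ := x
  by_cases h1 : d' = d
  · subst h1
    by_cases h2 : g' = g <;> simp [ActiveTile.execOn, h2]
  · simp [ActiveTile.execOn, h1]

lemma TileInv.exec {n j m : ℕ} {t : LineTile m} (h : TileInv n j t) {d : Dir} {g : LineGlue m}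
    {P : Multiset (Action (LineGlue m) Unit)} (hP : P ≤ t.pending) (hl : Legit n j (d, g)) :
    TileInv n j (t.execOn d g P) := by
  refine ⟨h.delta, fun x hx => ?_, fun x hx => ?_, fun hj x hx => ?_, fun hj => ?_,
    fun a ha => h.pend a (Multiset.mem_of_le hP ha)⟩
  · rw [execOn_G]; split_ifs
    · exact .inr rfl
    · exact h.state x hx
  · rw [execOn_G] at hx; split_ifs at hx with hx'
    · exact hx' ▸ hl
    · exact h.sound x hx
  · rw [execOn_G]; split_ifs
    · rfl
    · exact h.seed_on hj x hx
  · rw [execOn_G t d g P (.west, none)]; split_ifs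
    · rfl
    · exact h.west_on hj

/-! ### Bonds and cuts -/

open Assembly

lemma glueOn_iff {Γ Λ : Type} {A : Assembly Γ Λ} {p : ℤ × ℤ} {d : Dir} {g : Γ} :
    A.GlueOn p d g ↔ ∃ t, A p = some t ∧ t.G d g = some .on := by
  simp [GlueOn, Option.bind_eq_some_iff]

lemma mem_bonds {Γ Λ : Type} [Fintype Γ] [DecidableEq Γ] {A : Assembly Γ Λ} {p : ℤ × ℤ}
    {x : Dir × Γ} :
    x ∈ A.bonds p ↔ A.GlueOn p x.1 x.2 ∧ A.GlueOn (p + x.1.vec) x.1.opp x.2 := by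
  simp [bonds]

lemma glueOn_fireNew {Γ Λ : Type} [Fintype Γ] [DecidableEq Γ] {A : Assembly Γ Λ}
    {old : ℤ × ℤ → Finset (Dir × Γ)} {p : ℤ × ℤ} {d : Dir} {g : Γ} :
    (fireNew old A).GlueOn p d g ↔ A.GlueOn p d g := by
  simp only [GlueOn, fireNew]
  cases A p <;> rfl

lemma bonds_fireNew {Γ Λ : Type} [Fintype Γ] [DecidableEq Γ] {A : Assembly Γ Λ}
    {old : ℤ × ℤ → Finset (Dir × Γ)} : (fireNew old A).bonds = A.bonds := by
  funext p
  ext x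
  simp only [mem_bonds, glueOn_fireNew]

lemma Dir.opp_opp (d : Dir) : d.opp.opp = d := by cases d <;> rfl

lemma Dir.vec_opp (d : Dir) : d.opp.vec = -d.vec := by cases d <;> rfl

/-- With unit strengths nothing cancels, so one bond across the cut suffices at temperature 1. -/
lemma one_le_cutStrength {Γ Λ : Type} [Fintype Γ] [DecidableEq Γ] {s : Finset (ℤ × ℤ)}
    {p : ℤ × ℤ} {x : Dir × Γ} {A : Assembly Γ Λ} (hp : p ∈ s) (hx : x ∈ A.bonds p) (hs : p + x.1.vec ∉ s) :
    1 ≤ A.cutStrength (fun _ => 1) s := by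
  have h0 : ∀ q ∈ s, (0 : ℤ) ≤ ∑ x ∈ (A.bonds q).filter (fun x => q + x.1.vec ∉ s), 1 :=
    fun _ _ => Finset.sum_nonneg fun _ _ => zero_le_one
  have h1 := Finset.single_le_sum h0 hp
  have h2 := Finset.card_pos.2
    ⟨x, (Finset.mem_filter (p := fun x : Dir × Γ => p + x.1.vec ∉ s)).2 ⟨hx, hs⟩⟩
  refine le_trans ?_ h1
  rw [Finset.sum_const, nsmul_eq_mul, mul_one]
  exact_mod_cast h2

/-! ### The invariant of a line -/

/-- The `j`-th position of the row that starts at `o`. -/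
def rowPos (o : ℤ × ℤ) (j : ℕ) : ℤ × ℤ := (o.1 + j, o.2)

lemma rowPos_injective (o : ℤ × ℤ) : Function.Injective (rowPos o) := by
  intro i j h
  simpa [rowPos] using h

lemma rowPos_add_east (o : ℤ × ℤ) (j : ℕ) : rowPos o j + Dir.vec .east = rowPos o (j + 1) := by
  ext <;> simp [rowPos, Dir.vec, add_assoc]

lemma rowPos_add_west (o : ℤ × ℤ) (j : ℕ) : rowPos o (j + 1) + Dir.vec .west = rowPos o j := by
  ext <;> simp [rowPos, Dir.vec]; ring

/-- The invariant of a growing line of length `k` that starts at `o`, where of the bound glues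
only those in `old` need have fired. -/
structure LineInv (n k : ℕ) {m : ℕ} (o : ℤ × ℤ) (old : ℤ × ℤ → Finset (Dir × LineGlue m))
    (A : Assembly (LineGlue m) Unit) : Prop where
  pos : 0 < k
  le : k ≤ n
  occ : ∀ p t, A p = some t → ∃ j < k, p = rowPos o j ∧ TileInv n j t
  tile : ∀ j < k, A (rowPos o j) ≠ none
  link : ∀ j, j + 1 < k → A.GlueOn (rowPos o j) .east none
  fired : ∀ p t x y, A p = some t → x ∈ old p → x ∈ A.bonds p → Trig x y →
    t.G y.1 y.2 = some .on ∨ turnOn m y ∈ t.pending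

namespace LineInv

variable {n k m : ℕ} {o : ℤ × ℤ} {old : ℤ × ℤ → Finset (Dir × LineGlue m)}
  {A : Assembly (LineGlue m) Unit}

lemma exists_tile (h : LineInv n k o old A) {j : ℕ} (hj : j < k) :
    ∃ t, A (rowPos o j) = some t ∧ TileInv n j t := by
  obtain ⟨t, ht⟩ := Option.ne_none_iff_exists'.1 (h.tile j hj)
  obtain ⟨i, hi, e, hT⟩ := h.occ _ _ ht
  obtain rfl := rowPos_injective o e
  exact ⟨t, ht, hT⟩

lemma glueOn (h : LineInv n k o old A) {p : ℤ × ℤ} {d : Dir} {g : LineGlue m}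
    (hg : A.GlueOn p d g) : ∃ j < k, p = rowPos o j ∧ Legit n j (d, g) := by
  obtain ⟨t, ht, hg⟩ := glueOn_iff.1 hg
  obtain ⟨j, hj, e, hT⟩ := h.occ _ _ ht
  exact ⟨j, hj, e, hT.sound (d, g) hg⟩

/-- Only west glues trigger, so the other end of the bond is the preceding tile of the row and
`Trig.legit` applies. -/
lemma trig_legit (h : LineInv n k o old A) {j : ℕ} {x y : Dir × LineGlue m}
    (hx : x ∈ A.bonds (rowPos o j)) (hy : Trig x y) : Legit n j y := by
  obtain ⟨d, g⟩ := x
  obtain rfl : d = .west := hy.fst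
  obtain ⟨h1, h2⟩ := mem_bonds.1 hx
  obtain ⟨i, hi, e, hl⟩ := h.glueOn h1
  obtain rfl := rowPos_injective o e
  obtain ⟨i, hi', e, hl'⟩ := h.glueOn h2
  obtain rfl : j = i + 1 := by
    have := congrArg Prod.fst e
    simp only [rowPos, Dir.vec, Prod.fst_add] at this
    omega
  exact Trig.legit (hi.trans_le h.le) hl hl' hy

/-- Firing puts the requests of the bonds outside `old` among the pending actions and changes no
glue state, hence no bond; afterwards the invariant holds for all bonds. -/
lemma fireNew (h : LineInv n k o old A) :
    LineInv n k o (fireNew old A).bonds (fireNew old A) := by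
  have key : ∀ p t, Assembly.fireNew old A p = some t →
      ∃ t', A p = some t' ∧ t = t'.fire (A.bonds p \ old p) := by
    intro p t ht
    obtain ⟨t', h1, h2⟩ := Option.map_eq_some_iff.1 ht
    exact ⟨t', h1, h2.symm⟩
  refine ⟨h.pos, h.le, fun p t ht => ?_, fun j hj => ?_, fun j hj => ?_,
    fun p t x y ht hx _ hy => ?_⟩
  · obtain ⟨t', ht', rfl⟩ := key p t ht
    obtain ⟨j, hj, rfl, hT⟩ := h.occ p t' ht'
    refine ⟨j, hj, rfl, hT.fire fun x hx y hy => h.trig_legit (Finset.mem_sdiff.1 hx).1 hy⟩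
  · simpa [Assembly.fireNew] using h.tile j hj
  · exact glueOn_fireNew.2 (h.link j hj)
  · obtain ⟨t', ht', rfl⟩ := key p t ht
    rw [bonds_fireNew] at hx
    by_cases ho : x ∈ old p
    · exact (h.fired p t' x y ht' ho hx hy).imp id fun h => Multiset.mem_add.2 (.inl h)
    · refine .inr (Multiset.mem_add.2 (.inr (Multiset.mem_sum.2
        ⟨x, Finset.mem_sdiff.2 ⟨hx, ho⟩, ?_⟩)))
      obtain ⟨j, hj, rfl, hT⟩ := h.occ p t' ht'
      rw [hT.delta]
      exact mem_lineδ.2 ⟨y, hy, rfl⟩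

lemma link_west (h : LineInv n k o old A) {j : ℕ} (hj : j + 1 < k) :
    A.GlueOn (rowPos o (j + 1)) .west none := by
  obtain ⟨t, ht, hT⟩ := h.exists_tile hj
  exact glueOn_iff.2 ⟨t, ht, hT.west_on (by omega)⟩

lemma shift (h : LineInv n k o A.bonds A) (v : ℤ × ℤ) :
    LineInv n k (o + v) (A.shift v).bonds (A.shift v) := by
  have hp : ∀ j, rowPos (o + v) j - v = rowPos o j := fun j => by
    ext <;> simp [rowPos]; ring
  have hb : ∀ p, (A.shift v).bonds p = A.bonds (p - v) := fun p => by
    ext x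
    rw [mem_bonds, mem_bonds, sub_add_eq_add_sub]
    rfl
  refine ⟨h.pos, h.le, fun p t ht => ?_, fun j hj => ?_, fun j hj => ?_,
    fun p t x y ht hx _ hy => ?_⟩
  · obtain ⟨j, hj, e, hT⟩ := h.occ (p - v) t ht
    exact ⟨j, hj, by rw [← hp j] at e; exact sub_left_injective e, hT⟩
  · change A (_ - v) ≠ none
    rw [hp]
    exact h.tile j hj
  · change A.GlueOn (_ - v) _ _
    rw [hp]
    exact h.link j hj
  · rw [hb] at hx
    exact h.fired (p - v) t x y ht hx hx hy

/-- Consecutive tiles are joined by the attaching glue, and any cut separates some two consecutive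
tiles. -/
lemma stable (h : LineInv n k o old A) : A.Stable (fun _ => 1) 1 := by
  rintro s ⟨⟨p, hp, hA⟩, q, hq, hA'⟩
  obtain ⟨t, ht⟩ := Option.ne_none_iff_exists'.1 hA
  obtain ⟨t', ht'⟩ := Option.ne_none_iff_exists'.1 hA'
  obtain ⟨i, hi, rfl, -⟩ := h.occ _ _ ht
  obtain ⟨j, hj, rfl, -⟩ := h.occ _ _ ht'
  have key : ∃ l, l + 1 < k ∧ ¬ (rowPos o l ∈ s ↔ rowPos o (l + 1) ∈ s) := by
    by_contra! hc
    have : ∀ l < k, (rowPos o l ∈ s ↔ rowPos o 0 ∈ s) := by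
      intro l
      induction l with
      | zero => simp
      | succ l ih => exact fun hl => (hc l hl).symm.trans (ih (by omega))
    exact hq ((this j hj).2 ((this i hi).1 hp))
  obtain ⟨l, hl, hs⟩ := key
  by_cases hm : rowPos o l ∈ s
  · have hm' : rowPos o (l + 1) ∉ s := fun h => hs (by simp [h, hm])
    refine one_le_cutStrength hm (x := (.east, none)) (mem_bonds.2 ⟨h.link l hl, ?_⟩) ?_
    · rw [rowPos_add_east]; exact h.link_west hl
    · rwa [rowPos_add_east]
  · have hm' : rowPos o (l + 1) ∈ s := by by_contra h; exact hs (by simp [h, hm])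
    refine one_le_cutStrength hm' (x := (.west, none)) (mem_bonds.2 ⟨h.link_west hl, ?_⟩) ?_
    · rw [rowPos_add_west]; exact h.link l hl
    · rwa [rowPos_add_west]

end LineInv

/-! ### Combination of two supertiles -/

section Combine

variable {Γ Λ : Type} {A B C : Assembly Γ Λ}

lemma Assembly.union_comm_of_disjoint (h : ∀ p, A p = none ∨ B p = none) :
    A.union B = B.union A := by
  funext p
  rcases h p with h | h <;> simp [union, h]

lemma union_eq_some (h : ∀ p, A p = none ∨ B p = none) {p : ℤ × ℤ} {t : ActiveTile Γ Λ} :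
    A.union B p = some t ↔ A p = some t ∨ B p = some t := by
  rcases h p with h | h <;> simp [union, h]

lemma glueOn_union (h : ∀ p, A p = none ∨ B p = none) {p : ℤ × ℤ} {d : Dir} {g : Γ} :
    (A.union B).GlueOn p d g ↔ A.GlueOn p d g ∨ B.GlueOn p d g := by
  simp only [glueOn_iff, union_eq_some h, or_and_right, exists_or]

variable [Fintype Γ] [DecidableEq Γ] {strength : Γ → ℤ}

/-- Combining supertiles share a bond. -/
lemma CombinesInto.exists_bond {τ : ℕ} (hτ : 0 < τ) (h : A.CombinesInto strength τ B C) :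
    ∃ p d g, A.GlueOn p d g ∧ B.GlueOn (p + d.vec) d.opp g := by
  obtain ⟨s, hs, hb⟩ := h.binds
  have h0 : (A.union B).cutStrength strength s ≠ 0 := by
    have : (0 : ℤ) < τ := by exact_mod_cast hτ
    omega
  obtain ⟨p, hp, h1⟩ := Finset.exists_ne_zero_of_sum_ne_zero h0
  obtain ⟨x, hx, -⟩ := Finset.exists_ne_zero_of_sum_ne_zero h1
  obtain ⟨hx, hn⟩ := Finset.mem_filter.1 hx
  rw [mem_bonds, glueOn_union h.disjoint, glueOn_union h.disjoint] at hx
  -- The cut `s` is the domain of `A`, so the inner end of the bond lies in `A` and the outer end in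
  -- `B`.
  have hBp : B p = none := (h.disjoint p).resolve_left ((hs p).1 hp)
  have hAq : A (p + x.1.vec) = none := by
    by_contra hc
    exact hn ((hs _).2 hc)
  refine ⟨p, x.1, x.2, hx.1.resolve_right ?_, hx.2.resolve_left ?_⟩ <;>
    simp [glueOn_iff, hBp, hAq]

lemma combinesInto_of_bond {p : ℤ × ℤ} {d : Dir} {g : Γ} {s : Finset (ℤ × ℤ)}
    (hA : A.Stable (fun _ => 1) 1) (hB : B.Stable (fun _ => 1) 1)
    (hd : ∀ p, A p = none ∨ B p = none) (hs : ∀ p, p ∈ s ↔ A p ≠ none)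
    (h1 : A.GlueOn p d g) (h2 : B.GlueOn (p + d.vec) d.opp g) :
    A.CombinesInto (fun _ => 1) 1 B ((A.union B).fireNew fun p => A.bonds p ∪ B.bonds p) := by
  refine ⟨hA, hB, hd, ⟨s, hs, ?_⟩, rfl⟩
  obtain ⟨t, ht, -⟩ := glueOn_iff.1 h1
  obtain ⟨t', ht', -⟩ := glueOn_iff.1 h2
  refine one_le_cutStrength (p := p) (x := (d, g)) ((hs p).2 (by simp [ht])) ?_ ?_
  · rw [mem_bonds, glueOn_union hd, glueOn_union hd]
    exact ⟨.inl h1, .inr h2⟩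
  · rw [hs, not_not]
    exact (hd _).resolve_right (by simp [ht'])

end Combine

/-! ### Lone fillers and the growth of lines -/

/-- A single filler tile at the position `w`. -/
noncomputable def loneFiller (m : ℕ) (σ : State) (w : ℤ × ℤ) : Assembly (LineGlue m) Unit :=
  (single (filler m σ)).shift w

lemma loneFiller_eq_some {m : ℕ} {σ : State} {w p : ℤ × ℤ} {t : LineTile m} :
    loneFiller m σ w p = some t ↔ p = w ∧ t = filler m σ := by
  simp only [loneFiller, shift, single, sub_eq_zero]
  split_ifs with h <;> simp [h, eq_comm]

lemma loneFiller_glueOn {m : ℕ} {σ : State} {w p : ℤ × ℤ} {d : Dir} {g : LineGlue m} :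
    (loneFiller m σ w).GlueOn p d g ↔ p = w ∧ d = .west ∧ g = none := by
  simp only [glueOn_iff, loneFiller_eq_some]
  constructor
  · rintro ⟨t, ⟨rfl, rfl⟩, h⟩
    simp only [filler] at h
    split_ifs at h <;> simp_all
  · rintro ⟨rfl, rfl, rfl⟩
    exact ⟨_, ⟨rfl, rfl⟩, by simp [filler]⟩

lemma loneFiller_shift {m : ℕ} {σ : State} {w v : ℤ × ℤ} :
    (loneFiller m σ w).shift v = loneFiller m σ (w + v) := by
  funext p
  simp only [loneFiller, shift]
  congr 1
  abel

lemma loneFiller_not_isCut {m : ℕ} {σ : State} {w : ℤ × ℤ} {s : Finset (ℤ × ℤ)} :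
    ¬ (loneFiller m σ w).IsCut s := by
  rintro ⟨⟨p, hp, h⟩, q, hq, h'⟩
  obtain ⟨t, ht⟩ := Option.ne_none_iff_exists'.1 h
  obtain ⟨t', ht'⟩ := Option.ne_none_iff_exists'.1 h'
  obtain ⟨rfl, -⟩ := loneFiller_eq_some.1 ht
  obtain ⟨rfl, -⟩ := loneFiller_eq_some.1 ht'
  exact hq hp

lemma loneFiller_stable {m : ℕ} {σ : State} {w : ℤ × ℤ} :
    (loneFiller m σ w).Stable (fun _ => 1) 1 :=
  fun _ h => (loneFiller_not_isCut h).elim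

lemma loneFiller_bonds {m : ℕ} {σ : State} {w p : ℤ × ℤ} : (loneFiller m σ w).bonds p = ∅ := by
  ext x
  simp only [mem_bonds, loneFiller_glueOn, Finset.notMem_empty, iff_false]
  rintro ⟨⟨-, h, -⟩, -, h', -⟩
  rw [h] at h'
  cases h'

variable {n k m : ℕ} {o w : ℤ × ℤ} {σ : State} {A B C : Assembly (LineGlue m) Unit}

lemma lineInv_seed (hn : 0 < n) : LineInv n 1 0 (single (seed n m)).bonds (single (seed n m)) := by
  have key : ∀ p t, single (seed n m) p = some t → p = rowPos 0 0 ∧ t = seed n m := by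
    intro p t h
    simp only [single] at h
    split_ifs at h with hp
    exact ⟨hp.trans (by simp [rowPos, Prod.zero_eq_mk]), by simpa using h.symm⟩
  refine ⟨one_pos, hn, fun p t ht => ?_, ?_, by omega, fun p t x y ht _ hx _ => ?_⟩
  · obtain ⟨hp, rfl⟩ := key p t ht
    exact ⟨0, one_pos, hp, tileInv_seed n m⟩
  · intro j hj
    obtain rfl : j = 0 := by omega
    rw [show rowPos 0 0 = 0 by ext <;> simp [rowPos]]
    simp [single]
  · obtain ⟨h1, h2⟩ := mem_bonds.1 hx
    obtain ⟨t1, ht1, -⟩ := glueOn_iff.1 h1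
    obtain ⟨t2, ht2, -⟩ := glueOn_iff.1 h2
    have := (key _ _ ht2).1.trans (key _ _ ht1).1.symm
    rw [add_eq_left] at this
    revert this
    cases x.1 <;> simp [Dir.vec]

/-- A filler that binds to a line binds to its eastern end. -/
lemma LineInv.eq_of_bond (h : LineInv n k o A.bonds A)
    (hd : ∀ p, A p = none ∨ loneFiller m σ w p = none) {p : ℤ × ℤ} {d : Dir} {g : LineGlue m}
    (h1 : A.GlueOn p d g) (h2 : (loneFiller m σ w).GlueOn (p + d.vec) d.opp g) :
    w = rowPos o k ∧ k < n ∧ A.GlueOn (rowPos o (k - 1)) .east none := by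
  obtain ⟨rfl, hd', rfl⟩ := loneFiller_glueOn.1 h2
  obtain rfl : d = .east := by cases d <;> cases hd'; rfl
  obtain ⟨j, hj, rfl, hl⟩ := h.glueOn h1
  rw [rowPos_add_east] at *
  -- Otherwise the filler would overlap tile `j + 1`.
  have hk : k = j + 1 := by
    by_contra hne
    have hA := h.tile (j + 1) (by omega)
    have := (hd (rowPos o (j + 1))).resolve_left hA
    rw [Option.eq_none_iff_forall_ne_some] at this
    exact this _ (loneFiller_eq_some.2 ⟨rfl, rfl⟩)
  subst hk
  exact ⟨rfl, hl, h1⟩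

/-- Before firing, the union satisfies the invariant relative to the bonds of `A`, as the filler has
none; `LineInv.fireNew` settles the new ones. Giving `old` by a pointwise equation lets the filler
be either of the two partners. -/
lemma LineInv.attach (h : LineInv n k o A.bonds A)
    (hd : ∀ p, A p = none ∨ loneFiller m σ w p = none) {p : ℤ × ℤ} {d : Dir} {g : LineGlue m}
    (h1 : A.GlueOn p d g) (h2 : (loneFiller m σ w).GlueOn (p + d.vec) d.opp g)
    {old : ℤ × ℤ → Finset (Dir × LineGlue m)}
    (ho : ∀ p, old p = A.bonds p ∪ (loneFiller m σ w).bonds p) :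
    LineInv n (k + 1) o ((A.union (loneFiller m σ w)).fireNew old).bonds
      ((A.union (loneFiller m σ w)).fireNew old) := by
  obtain ⟨rfl, hk, he⟩ := h.eq_of_bond hd h1 h2
  have hpos := h.pos
  refine LineInv.fireNew ⟨by omega, hk, fun p t ht => ?_, fun j hj => ?_, fun j hj => ?_,
    fun p t x y ht hx _ hy => ?_⟩
  · rcases (union_eq_some hd).1 ht with ht | ht
    · obtain ⟨j, hj, e, hT⟩ := h.occ p t ht
      exact ⟨j, by omega, e, hT⟩
    · obtain ⟨rfl, rfl⟩ := loneFiller_eq_some.1 ht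
      exact ⟨k, by omega, rfl, tileInv_filler n m σ hpos⟩
  · rw [Option.ne_none_iff_exists']
    rcases Nat.lt_succ_iff_lt_or_eq.1 hj with hj | rfl
    · obtain ⟨t, ht⟩ := Option.ne_none_iff_exists'.1 (h.tile j hj)
      exact ⟨t, (union_eq_some hd).2 (.inl ht)⟩
    · exact ⟨_, (union_eq_some hd).2 (.inr (loneFiller_eq_some.2 ⟨rfl, rfl⟩))⟩
  · rw [glueOn_union hd]
    left
    rcases Nat.lt_succ_iff_lt_or_eq.1 hj with hj | rfl
    · exact h.link j hj
    · exact he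
  · rw [ho, loneFiller_bonds, Finset.union_empty] at hx
    have hxA := (mem_bonds.1 hx).1
    obtain ⟨t', ht', -⟩ := glueOn_iff.1 hxA
    have : A p = some t := by
      rcases (union_eq_some hd).1 ht with ht | ht
      · exact ht
      · rcases hd p with h | h
        · rw [h] at ht'; cases ht'
        · rw [h] at ht; cases ht
    exact h.fired p t x y this hx hx hy

/-- Two lines do not bind. -/
lemma LineInv.not_bond {k' : ℕ} {o' : ℤ × ℤ} (h : LineInv n k o A.bonds A)
    (h' : LineInv n k' o' B.bonds B) (hd : ∀ p, A p = none ∨ B p = none) {p : ℤ × ℤ} {d : Dir}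
    {g : LineGlue m} (h1 : A.GlueOn p d g) (h2 : B.GlueOn (p + d.vec) d.opp g) : False := by
  obtain ⟨i, hi, rfl, hl⟩ := h.glueOn h1
  obtain ⟨j, hj, e, hl'⟩ := h'.glueOn h2
  cases d with
  | north => exact hl
  | south => exact hl
  | east =>
    -- A west glue is legitimate only at a positive index; the western neighbour of that tile in its
    -- own line then occupies the cell of the other line's tile.
    obtain ⟨j, rfl⟩ : ∃ j', j = j' + 1 := ⟨j - 1, by
      have : 0 < j := by
        cases g with
        | none => exact hl'
        | some g => exact hl'.1
      omega⟩
    rw [← rowPos_add_east] at e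
    have e' := add_right_cancel e
    rcases hd (rowPos o i) with h0 | h0
    · exact h.tile i hi h0
    · rw [e'] at h0; exact h'.tile j (by omega) h0
  | west =>
    obtain ⟨i, rfl⟩ : ∃ i', i = i' + 1 := ⟨i - 1, by
      have : 0 < i := by
        cases g with
        | none => exact hl
        | some g => exact hl.1
      omega⟩
    rw [rowPos_add_west] at e
    rcases hd (rowPos o i) with h0 | h0
    · exact h.tile i (by omega) h0
    · rw [e] at h0; exact h'.tile j hj h0

/-- The invariant of the producible supertiles. -/
def SupertileInv (n : ℕ) {m : ℕ} (A : Assembly (LineGlue m) Unit) : Prop :=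
  (∃ σ w, A = loneFiller m σ w) ∨ ∃ k o, LineInv n k o A.bonds A

lemma SupertileInv.shift (h : SupertileInv n A) (v : ℤ × ℤ) : SupertileInv n (A.shift v) := by
  rcases h with ⟨σ, w, rfl⟩ | ⟨k, o, h⟩
  · exact .inl ⟨_, _, loneFiller_shift⟩
  · exact .inr ⟨_, _, h.shift v⟩

/-- A line combines with filler tiles only, and grows by one. -/
lemma LineInv.combine (hA : LineInv n k o A.bonds A) (hB : SupertileInv n B)
    (h : A.CombinesInto (fun _ => 1) 1 B C) : LineInv n (k + 1) o C.bonds C := by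
  obtain ⟨p, d, g, h1, h2⟩ := CombinesInto.exists_bond one_pos h
  rcases hB with ⟨σ, w, rfl⟩ | ⟨k', o', hB⟩
  · rw [h.result]
    exact hA.attach h.disjoint h1 h2 fun p => rfl
  · exact (hA.not_bond hB h.disjoint h1 h2).elim

/-- A single filler tile combines with lines only. -/
lemma loneFiller_combine (hB : SupertileInv n B)
    (h : (loneFiller m σ w).CombinesInto (fun _ => 1) 1 B C) :
    ∃ k o, LineInv n k o C.bonds C := by
  obtain ⟨p, d, g, h1, h2⟩ := CombinesInto.exists_bond one_pos h
  rcases hB with ⟨σ', w', rfl⟩ | ⟨k', o', hB⟩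
  · obtain ⟨-, rfl, -⟩ := loneFiller_glueOn.1 h1
    obtain ⟨-, h2, -⟩ := loneFiller_glueOn.1 h2
    cases h2
  · have hd : ∀ p, B p = none ∨ loneFiller m σ w p = none := fun p => (h.disjoint p).symm
    refine ⟨k' + 1, o', ?_⟩
    rw [h.result, union_comm_of_disjoint h.disjoint]
    refine hB.attach hd h2 (d := d.opp) (g := g) ?_ fun p => Finset.union_comm _ _
    rwa [Dir.vec_opp, add_neg_cancel_right, Dir.opp_opp]

/-! ### Glue transitions and the termination measure -/

/-- The number of latent glues of a tile. -/
def latentCount {m : ℕ} (t : LineTile m) : ℕ :=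
  ((Finset.univ : Finset (Dir × LineGlue m)).filter fun x => t.G x.1 x.2 = some .latent).card

/-- The number of latent glues of a row of `k` tiles. -/
def rowLatent {m : ℕ} (o : ℤ × ℤ) (k : ℕ) (A : Assembly (LineGlue m) Unit) : ℕ :=
  ∑ j ∈ Finset.range k, (A (rowPos o j)).elim 0 latentCount

/-- The number of pending actions of a row of `k` tiles. -/
def rowPending {m : ℕ} (o : ℤ × ℤ) (k : ℕ) (A : Assembly (LineGlue m) Unit) : ℕ :=
  ∑ j ∈ Finset.range k, (A (rowPos o j)).elim 0 fun t => t.pending.card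

lemma latentCount_execOn {t : LineTile m} {d : Dir} {g : LineGlue m}
    {P : Multiset (Action (LineGlue m) Unit)} (h : t.G d g = some .latent) :
    latentCount (t.execOn d g P) < latentCount t := by
  refine Finset.card_lt_card (Finset.ssubset_iff_of_subset ?_ |>.2 ⟨(d, g), ?_, ?_⟩)
  · intro x hx
    have hx := (Finset.mem_filter.1 hx).2
    rw [execOn_G] at hx
    split_ifs at hx
    · simp at hx
    · exact Finset.mem_filter.2 ⟨Finset.mem_univ _, hx⟩
  · exact Finset.mem_filter.2 ⟨Finset.mem_univ _, h⟩
  · intro hx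
    have hx := (Finset.mem_filter.1 hx).2
    rw [execOn_G, if_pos rfl] at hx
    simp at hx

lemma execOn_G_of_on {t : LineTile m} {d : Dir} {g : LineGlue m}
    {P : Multiset (Action (LineGlue m) Unit)} (h : t.G d g = some .on) :
    (t.execOn d g P).G = t.G := by
  funext d' g'
  refine (execOn_G t d g P (d', g')).trans ?_
  split_ifs with e
  · cases e; exact h.symm
  · rfl

lemma fireNew_bonds_self : A.fireNew A.bonds = A := by
  funext p
  simp only [fireNew, Finset.sdiff_self, ActiveTile.fire, Finset.sum_empty, add_zero]
  exact Option.map_id' ..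

namespace LineInv

/-- `old` stays at `A.bonds`, since bonds made by the new glue have yet to fire. For older bonds,
the executed request passes from pending to fulfilled. -/
lemma update (h : LineInv n k o A.bonds A) {p : ℤ × ℤ} {t : LineTile m} {d : Dir} {g : LineGlue m}
    {P : Multiset (Action (LineGlue m) Unit)} (ht : A p = some t)
    (hP : t.pending = turnOn m (d, g) ::ₘ P) (hl : ∀ j, TileInv n j t → Legit n j (d, g)) :
    LineInv n k o A.bonds (Function.update A p (some (t.execOn d g P))) := by
  have key : ∀ q t', Function.update A p (some (t.execOn d g P)) q = some t' →
      (q = p ∧ t' = t.execOn d g P) ∨ A q = some t' := by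
    intro q t' hq
    by_cases e : q = p
    · subst e
      rw [Function.update_self] at hq
      exact .inl ⟨rfl, (Option.some.inj hq).symm⟩
    · rw [Function.update_of_ne e] at hq
      exact .inr hq
  have on_mono : ∀ x : Dir × LineGlue m, t.G x.1 x.2 = some .on →
      (t.execOn d g P).G x.1 x.2 = some .on := by
    intro x hx
    rw [execOn_G]
    split_ifs
    · rfl
    · exact hx
  refine ⟨h.pos, h.le, fun q t' hq => ?_, fun j hj => ?_, fun j hj => ?_,
    fun q t' x y hq hx _ hy => ?_⟩
  · rcases key q t' hq with ⟨rfl, rfl⟩ | hq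
    · obtain ⟨j, hj, e, hT⟩ := h.occ q t ht
      exact ⟨j, hj, e, hT.exec (hP ▸ Multiset.le_cons_self _ _) (hl j hT)⟩
    · exact h.occ q t' hq
  · by_cases e : rowPos o j = p
    · rw [e, Function.update_self]; simp
    · rw [Function.update_of_ne e]; exact h.tile j hj
  · obtain ⟨t', ht', hg⟩ := glueOn_iff.1 (h.link j hj)
    by_cases e : rowPos o j = p
    · rw [e] at ht' ⊢
      obtain rfl : t = t' := Option.some.inj (ht.symm.trans ht')
      exact glueOn_iff.2 ⟨_, Function.update_self .., on_mono (.east, none) hg⟩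
    · exact glueOn_iff.2 ⟨t', by rw [Function.update_of_ne e]; exact ht', hg⟩
  · by_cases e : q = p
    · subst e
      rw [Function.update_self] at hq
      obtain rfl := Option.some.inj hq
      rcases h.fired q t x y ht hx hx hy with hf | hf
      · exact .inl (on_mono y hf)
      · rw [hP, Multiset.mem_cons] at hf
        refine hf.imp (fun hf => ?_) id
        rw [(turnOn m).injective hf, execOn_G, if_pos rfl]
    · rw [Function.update_of_ne e] at hq
      exact h.fired q t' x y hq hx hx hy

/-- Turning on a latent glue may create pending actions, but uses up that latent glue for good. A
request for a glue already on creates no bond, so it merely consumes a pending action. -/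
lemma glueTransition (h : LineInv n k o A.bonds A) (hB : A.GlueTransition B) :
    LineInv n k o B.bonds B ∧ (rowLatent o k B < rowLatent o k A ∨
      rowLatent o k B = rowLatent o k A ∧ rowPending o k B < rowPending o k A) := by
  obtain ⟨p, t, d, g, s, q, P, ht, hs, hP, hB⟩ := hB
  have hx : q = .on ∧ ∀ j, TileInv n j t → Legit n j (d, g) := by
    have key : ∀ j, TileInv n j t → q = .on ∧ Legit n j (d, g) := by
      intro j hT
      obtain ⟨⟨d', g'⟩, e, hl⟩ := hT.pend (.glue d g q) (by simp [hP])
      cases e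
      exact ⟨rfl, hl⟩
    obtain ⟨j, -, -, hT⟩ := h.occ p t ht
    exact ⟨(key j hT).1, fun j hT => (key j hT).2⟩
  obtain ⟨rfl, hl⟩ := hx
  obtain ⟨i, hi, rfl, hT⟩ := h.occ p t ht
  have hs' : s = .latent ∨ s = .on := by
    have := hT.state _ (hl i hT)
    simpa only [hs, Option.some.injEq] using this
  have hBf : B = Assembly.fireNew A.bonds
      (Function.update A (rowPos o i) (some (t.execOn d g P))) := by
    rw [hB]
    rcases hs' with rfl | rfl <;> rfl
  have hne : ∀ j, j ≠ i → rowPos o j ≠ rowPos o i := fun j hj e => hj (rowPos_injective o e)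
  refine ⟨hBf ▸ (h.update ht hP hl).fireNew, ?_⟩
  have hle : ∀ j ∈ Finset.range k, j ≠ i → (B (rowPos o j)).elim 0 latentCount
      = (A (rowPos o j)).elim 0 latentCount := by
    intro j _ hj
    rw [hBf, Assembly.fireNew, Function.update_of_ne (hne j hj)]
    cases A (rowPos o j) <;> rfl
  have hBi : (B (rowPos o i)).elim 0 latentCount = latentCount (t.execOn d g P) := by
    rw [hBf, Assembly.fireNew, Function.update_self]
    rfl
  rcases hs' with rfl | rfl
  · left
    have hlt : (B (rowPos o i)).elim 0 latentCount < (A (rowPos o i)).elim 0 latentCount := by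
      rw [hBi, ht]
      exact latentCount_execOn hs
    refine Finset.sum_lt_sum (fun j hj => ?_) ⟨i, Finset.mem_range.2 hi, hlt⟩
    by_cases e : j = i
    · rw [e]; exact hlt.le
    · exact (hle j hj e).le
  · right
    have hG := execOn_G_of_on (P := P) hs
    have hB : B = Function.update A (rowPos o i) (some (t.execOn d g P)) := by
      obtain ⟨A', hA'⟩ : ∃ A' : Assembly (LineGlue m) Unit,
        A' = Function.update A (rowPos o i) (some (t.execOn d g P)) := ⟨_, rfl⟩
      have hgl : ∀ q d' g', A'.GlueOn q d' g' ↔ A.GlueOn q d' g' := by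
        intro q d' g'
        by_cases e : q = rowPos o i
        · simp [GlueOn, hA', e, ht, hG]
        · simp [GlueOn, hA', e]
      have hbonds : A.bonds = A'.bonds := by
        funext q
        ext x
        simp only [mem_bonds, hgl]
      rw [hBf, ← hA', hbonds, fireNew_bonds_self]
    constructor
    · refine Finset.sum_congr rfl fun j hj => ?_
      by_cases e : j = i
      · rw [e, hBi, ht]
        simp only [latentCount, hG, Option.elim]
      · exact hle j hj e
    · refine Finset.sum_lt_sum (fun j hj => ?_) ⟨i, Finset.mem_range.2 hi, ?_⟩
      · by_cases e : j = i
        · rw [e, hB, Function.update_self, ht]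
          simp [ActiveTile.execOn, hP]
        · rw [hB, Function.update_of_ne (hne j e)]
      · rw [hB, Function.update_self, ht]
        simp [ActiveTile.execOn, hP]

lemma not_labelTransition (h : LineInv n k o A.bonds A) : ¬ A.LabelTransition B := by
  rintro ⟨p, t, x, s, q, P, L', ht, -, hP, -⟩
  obtain ⟨j, -, -, hT⟩ := h.occ p t ht
  obtain ⟨y, e, -⟩ := hT.pend (.label x q) (by simp [hP])
  cases e

lemma not_breaksInto (h : LineInv n k o A.bonds A) : ¬ A.BreaksInto (fun _ => 1) 1 B C := by
  rintro ⟨s, hs, hlt, -⟩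
  exact absurd (h.stable s hs) (not_le.2 hlt)

/-! ### Progress of lines without pending actions -/

lemma glueOn_of_trig (h : LineInv n k o A.bonds A) (hq : ∀ p t, A p = some t → t.pending = 0)
    {p : ℤ × ℤ} {x y : Dir × LineGlue m} (hx : x ∈ A.bonds p) (hy : Trig x y) :
    A.GlueOn p y.1 y.2 := by
  obtain ⟨t, ht, -⟩ := glueOn_iff.1 (mem_bonds.1 hx).1
  refine glueOn_iff.2 ⟨t, ht, (h.fired p t x y ht hx hx hy).resolve_right ?_⟩
  simp [hq p t ht]

/-- Without pending actions, the eastern glues of a line are as they should be. -/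
lemma glueOn_east (h : LineInv n k o A.bonds A) (hm : n ≤ 2 ^ m)
    (hq : ∀ p t, A p = some t → t.pending = 0) (j : ℕ) (hj : j < k) :
    ∀ g, Legit n j (.east, g) → A.GlueOn (rowPos o j) .east g := by
  induction j with
  | zero =>
    intro g hg
    obtain ⟨t, ht, hT⟩ := h.exists_tile hj
    exact glueOn_iff.2 ⟨t, ht, hT.seed_on rfl _ hg⟩
  | succ j ih =>
    have ih := ih (by omega)
    have hkn := h.le
    have e : n - 1 - j = n - (j + 1) := by omega
    have e' : n - 1 - (j + 1) = n - (j + 1) - 1 := by omega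
    have hbond : ∀ g, A.GlueOn (rowPos o j) .east g → A.GlueOn (rowPos o (j + 1)) .west g →
        (.west, g) ∈ A.bonds (rowPos o (j + 1)) := by
      intro g h1 h2
      refine mem_bonds.2 ⟨h2, ?_⟩
      rw [rowPos_add_west]
      exact h1
    -- The borrow ripples upwards: the bond at bit `i` has its east half from the outer induction
    -- and its west half from the inner one, and it switches on the west glues of bit `i + 1`.
    have hwest : ∀ i (hi : i < m) b, A.GlueOn (rowPos o (j + 1)) .west
        (some (⟨i, hi⟩, b, decide ((n - (j + 1)) % 2 ^ i = 0))) := by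
      intro i
      induction i with
      | zero =>
        intro hi b
        have := h.glueOn_of_trig hq (hbond none (h.link j hj) (h.link_west hj))
          (Trig.start ⟨0, hi⟩ b rfl)
        simpa [Nat.mod_one] using this
      | succ i ihi =>
        intro hi b
        have := h.glueOn_of_trig hq (hbond (some (⟨i, by omega⟩, (n - (j + 1)).testBit i, _))
          (ih _ (by simp only [Legit, e])) (ihi (by omega) _)) (Trig.borrow _ ⟨i + 1, hi⟩ _ _ b rfl)
        rwa [mod_two_pow_succ_eq_zero]
    have hrail : ∀ i : Fin m, (Dir.west, some (i, (n - (j + 1)).testBit i,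
        decide ((n - (j + 1)) % 2 ^ i.val = 0))) ∈ A.bonds (rowPos o (j + 1)) :=
      fun i => hbond _ (ih _ (by simp only [Legit, e])) (hwest i i.2 _)
    intro g hg
    rcases g with _ | ⟨i, b, c⟩
    · have hne : n - 1 - (j + 1) ≠ 0 := by
        simp only [Legit] at hg
        omega
      obtain ⟨i, hi⟩ := Nat.exists_testBit_of_ne_zero hne
      -- Here `n ≤ 2 ^ m` is needed: a 1 in the counter must sit at a bit that has glues.
      have him : i < m := by
        by_contra hc
        have : n - 1 - (j + 1) < 2 ^ i :=
          (by omega : _ < n).trans_le (hm.trans (Nat.pow_le_pow_right two_pos (not_lt.1 hc)))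
        rw [Nat.testBit_lt_two_pow this] at hi
        cases hi
      refine h.glueOn_of_trig hq (hrail ⟨i, him⟩) (Trig.attach _ _ _ ?_)
      rwa [← testBit_pred _ _ (by omega), ← e']
    · simp only [Legit] at hg
      rw [e', testBit_pred _ _ (by omega)] at hg
      subst hg
      exact h.glueOn_of_trig hq (hrail i) (Trig.bit _ _ _ c)

/-- By `TileInv.state` a requested glue is present on the tile, so the request can always be
executed. -/
lemma exists_glueTransition (h : LineInv n k o A.bonds A) {p : ℤ × ℤ} {t : LineTile m}
    (ht : A p = some t) (hp : t.pending ≠ 0) : ∃ B, A.GlueTransition B := by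
  obtain ⟨a, ha⟩ := Multiset.exists_mem_of_ne_zero hp
  obtain ⟨P, hP⟩ := Multiset.exists_cons_of_mem ha
  obtain ⟨j, -, -, hT⟩ := h.occ p t ht
  obtain ⟨⟨d, g⟩, rfl, hl⟩ := hT.pend a ha
  rcases hT.state _ hl with hs | hs <;>
    exact ⟨_, p, t, d, g, _, .on, P, ht, hs, hP, rfl⟩

lemma hasShape (h : LineInv n n o A.bonds A) : A.HasShape (line n) := by
  refine ⟨o, fun p => ⟨fun hp => ?_, fun hp => ?_⟩⟩
  · obtain ⟨t, ht⟩ := Option.ne_none_iff_exists'.1 hp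
    obtain ⟨j, hj, rfl, -⟩ := h.occ p t ht
    simp [line, rowPos, hj]
  · obtain ⟨h0, h1, h2⟩ := hp
    simp only [Prod.fst_sub, Prod.snd_sub] at h0 h1 h2
    have : p = rowPos o (p.1 - o.1).toNat := by
      ext
      · simp only [rowPos]; omega
      · simp only [rowPos]; omega
    rw [this]
    exact h.tile _ (by omega)

/-- A line of fewer than `n` tiles without pending actions can grow. -/
lemma exists_attach (h : LineInv n k o A.bonds A) (hm : n ≤ 2 ^ m)
    (hq : ∀ p t, A p = some t → t.pending = 0) (hk : k < n) (σ : State) :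
    ∃ C, A.CombinesInto (fun _ => 1) 1 ((single (filler m σ)).shift (rowPos o k)) C := by
  have hpos := h.pos
  refine ⟨_, combinesInto_of_bond (p := rowPos o (k - 1)) (d := .east) (g := none)
    (s := (Finset.range k).image (rowPos o)) h.stable loneFiller_stable ?_ ?_
    (h.glueOn_east hm hq (k - 1) (by omega) none ?_) (loneFiller_glueOn.2 ⟨?_, rfl, rfl⟩)⟩
  · intro p
    by_contra! hc
    obtain ⟨t, ht⟩ := Option.ne_none_iff_exists'.1 hc.1
    obtain ⟨t', ht'⟩ := Option.ne_none_iff_exists'.1 hc.2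
    obtain ⟨j, hj, e, -⟩ := h.occ p t ht
    obtain ⟨e', -⟩ := loneFiller_eq_some.1 ht'
    have := rowPos_injective o (e.symm.trans e')
    omega
  · intro p
    simp only [Finset.mem_image, Finset.mem_range]
    constructor
    · rintro ⟨j, hj, rfl⟩
      exact h.tile j hj
    · intro hp
      obtain ⟨t, ht⟩ := Option.ne_none_iff_exists'.1 hp
      obtain ⟨j, hj, e, -⟩ := h.occ p t ht
      exact ⟨j, hj, e.symm⟩
  · simp only [Legit]
    omega
  · rw [rowPos_add_east, Nat.sub_add_cancel hpos]

end LineInv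

lemma loneFiller_not_glueTransition : ¬ (loneFiller m σ w).GlueTransition B := by
  rintro ⟨p, t, d, g, s, q, P, ht, -, hP, -⟩
  obtain ⟨-, rfl⟩ := loneFiller_eq_some.1 ht
  simp [filler] at hP

lemma loneFiller_not_labelTransition : ¬ (loneFiller m σ w).LabelTransition B := by
  rintro ⟨p, t, x, s, q, P, L', ht, -, hP, -⟩
  obtain ⟨-, rfl⟩ := loneFiller_eq_some.1 ht
  simp [filler] at hP

lemma loneFiller_not_breaksInto : ¬ (loneFiller m σ w).BreaksInto (fun _ => 1) 1 B C := by
  rintro ⟨s, hs, -⟩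
  exact loneFiller_not_isCut hs

lemma loneFiller_hasShape : (loneFiller m σ w).HasShape (line 1) := by
  refine ⟨w, fun p => ?_⟩
  rw [Option.ne_none_iff_exists']
  simp only [loneFiller_eq_some, exists_and_left, exists_eq, and_true, line, Set.mem_ofPred_eq,
    Prod.ext_iff, Prod.fst_sub, Prod.snd_sub]
  push_cast
  omega

/-- A single filler tile can attach to the seed. -/
lemma loneFiller_exists_attach (hn : 1 < n) (m : ℕ) (σ : State) (w : ℤ × ℤ) :
    ∃ v C, (loneFiller m σ w).CombinesInto (fun _ => 1) 1 ((single (seed n m)).shift v) C := by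
  have hS := (lineInv_seed (m := m) (zero_lt_one.trans hn)).shift (w + Dir.vec .west)
  have h0 : (single (seed n m)).shift (w + Dir.vec .west) (w + Dir.vec .west)
      = some (seed n m) := by simp [Assembly.shift, single]
  refine ⟨w + Dir.vec .west, _, combinesInto_of_bond (p := w) (d := .west) (g := none) (s := {w})
    loneFiller_stable hS.stable ?_ ?_ (loneFiller_glueOn.2 ⟨rfl, rfl, rfl⟩)
    (glueOn_iff.2 ⟨_, h0, ?_⟩)⟩
  · intro p
    by_cases hp : p = w
    · subst hp
      right
      simp [Assembly.shift, single, Dir.vec]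
    · left
      rw [Option.eq_none_iff_forall_ne_some]
      exact fun t ht => hp (loneFiller_eq_some.1 ht).1
  · intro p
    rw [Option.ne_none_iff_exists']
    simp [loneFiller_eq_some]
  · exact (tileInv_seed n m).seed_on rfl (.east, none) hn

/-! ### Producible and terminal supertiles -/

lemma supertileInv_of_producible (hn : 0 < n) (h : (lineSystem n m).Producible A) :
    SupertileInv n A := by
  induction h with
  | initial t ht =>
    rcases ht with rfl | ⟨σ, rfl⟩
    · exact .inr ⟨_, _, lineInv_seed hn⟩
    · refine .inl ⟨σ, 0, ?_⟩
      funext p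
      simp [loneFiller, shift]
  | combine A B C v _ _ h ihA ihB =>
    rcases ihA with ⟨σ, w, rfl⟩ | ⟨k, o, hA⟩
    · exact .inr (loneFiller_combine (ihB.shift v) h)
    · exact .inr ⟨_, _, hA.combine (ihB.shift v) h⟩
  | break_ A B C _ h ih =>
    rcases ih with ⟨σ, w, rfl⟩ | ⟨k, o, hA⟩
    · exact (loneFiller_not_breaksInto h).elim
    · exact (hA.not_breaksInto h).elim
  | glue A B _ h ih =>
    rcases ih with ⟨σ, w, rfl⟩ | ⟨k, o, hA⟩
    · exact (loneFiller_not_glueTransition h).elim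
    · exact .inr ⟨_, _, (hA.glueTransition h).1⟩
  | label A B _ h ih =>
    rcases ih with ⟨σ, w, rfl⟩ | ⟨k, o, hA⟩
    · exact (loneFiller_not_labelTransition h).elim
    · exact (hA.not_labelTransition h).elim

lemma System.Producible.step {Γ Λ : Type} [Fintype Γ] [DecidableEq Γ] {S : System Γ Λ}
    {A C : Assembly Γ Λ} (hA : S.Producible A) (h : S.Step A C) : S.Producible C := by
  cases h with
  | combine B v hB h => exact .combine A B C v hA hB h
  | break_ B h => exact .break_ A C B hA h
  | glue h => exact .glue A C hA h
  | label h => exact .label A C hA h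

theorem LineInv.exists_terminal (hn : 0 < n) (k : ℕ) (o : ℤ × ℤ) (A : Assembly (LineGlue m) Unit)
    (h : LineInv n k o A.bonds A) (hA : (lineSystem n m).Producible A) :
    ∃ B, (lineSystem n m).Terminal B ∧ Relation.ReflTransGen (lineSystem n m).Step A B := by
  by_cases hT : ∀ C, ¬ (lineSystem n m).Step A C
  · exact ⟨A, ⟨hA, hT⟩, .refl⟩
  · push Not at hT
    obtain ⟨C, hC⟩ := hT
    have hCp := hA.step hC
    suffices ∃ B, (lineSystem n m).Terminal B ∧ Relation.ReflTransGen (lineSystem n m).Step C B by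
      obtain ⟨B, hB, hr⟩ := this
      exact ⟨B, hB, .head hC hr⟩
    cases hC with
    | combine B v hB hc =>
      have hC' := h.combine ((supertileInv_of_producible hn hB).shift v) hc
      have := hC'.le
      exact LineInv.exists_terminal hn (k + 1) o C hC' hCp
    | break_ B hb => exact (h.not_breaksInto hb).elim
    | glue hg =>
      have hg' := h.glueTransition hg
      exact LineInv.exists_terminal hn k o C hg'.1 hCp
    | label hl => exact (h.not_labelTransition hl).elim
-- A new tile brings latent glues and pending actions with it, so the length must come first.
termination_by (n - k, rowLatent o k A, rowPending o k A)
decreasing_by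
  · rw [Prod.lex_def]; left; simp only; omega
  · rw [Prod.lex_def]
    refine .inr ⟨rfl, ?_⟩
    rw [Prod.lex_def]
    exact hg'.2

lemma exists_terminal (hn : 0 < n) (hA : (lineSystem n m).Producible A) :
    ∃ B, (lineSystem n m).Terminal B ∧ Relation.ReflTransGen (lineSystem n m).Step A B := by
  rcases supertileInv_of_producible hn hA with ⟨σ, w, rfl⟩ | ⟨k, o, h⟩
  · by_cases hT : ∀ C, ¬ (lineSystem n m).Step (loneFiller m σ w) C
    · exact ⟨_, ⟨hA, hT⟩, .refl⟩
    · push Not at hT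
      obtain ⟨C, hC⟩ := hT
      have hCp := hA.step hC
      cases hC with
      | combine B v hB h =>
        obtain ⟨k, o, hC'⟩ :=
          loneFiller_combine ((supertileInv_of_producible hn hB).shift v) h
        obtain ⟨D, hD, hr⟩ := LineInv.exists_terminal hn k o C hC' hCp
        exact ⟨D, hD, .head (.combine B v hB h) hr⟩
      | break_ B h => exact (loneFiller_not_breaksInto h).elim
      | glue h => exact (loneFiller_not_glueTransition h).elim
      | label h => exact (loneFiller_not_labelTransition h).elim
  · exact LineInv.exists_terminal hn k o A h hA

lemma terminal_hasShape (hn : 0 < n) (hm : n ≤ 2 ^ m) (hA : (lineSystem n m).Terminal A) :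
    A.HasShape (line n) := by
  rcases supertileInv_of_producible hn hA.1 with ⟨σ, w, rfl⟩ | ⟨k, o, h⟩
  -- For `n = 1` a lone filler already has the right shape; for larger `n` it can still attach to a
  -- seed.
  · obtain rfl | hn' : n = 1 ∨ 1 < n := by omega
    · exact loneFiller_hasShape
    · obtain ⟨v, C, hC⟩ := loneFiller_exists_attach hn' m σ w
      exact (hA.2 C (.combine _ v (.initial _ (.inl rfl)) hC)).elim
  · have hq : ∀ p t, A p = some t → t.pending = 0 := by
      intro p t ht
      by_contra hp
      obtain ⟨B, hB⟩ := h.exists_glueTransition ht hp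
      exact hA.2 B (.glue hB)
    obtain rfl | hk := h.le.eq_or_lt
    · exact h.hasShape
    · obtain ⟨C, hC⟩ := h.exists_attach hm hq hk .on
      exact (hA.2 C (.combine _ _ (.initial _ (.inr ⟨_, rfl⟩)) hC)).elim

theorem lineSystem_uniquelyAssembles (hn : 0 < n) (hm : n ≤ 2 ^ m) :
    (lineSystem n m).UniquelyAssembles (line n) := by
  refine ⟨?_, fun A => terminal_hasShape hn hm, fun A => exists_terminal hn⟩
  obtain ⟨B, hB, -⟩ := exists_terminal (m := m) hn (.initial _ (.inl rfl))
  exact ⟨B, hB⟩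

/-! ### The logarithmic bound and the conclusion -/

lemma isBigO_natLog :
    (fun n : ℕ => ((4 * (4 * (Nat.log 2 n + 1) + 1) : ℕ) : ℝ)) =O[Filter.atTop]
      (fun n : ℕ => Real.log (n : ℝ)) := by
  have h2 : 0 < Real.log 2 := Real.log_pos one_lt_two
  -- With `L = Nat.log 2 n ≥ 1` the count is `16 L + 20 ≤ 36 L`, and `L * Real.log 2 ≤ Real.log n`.
  refine Asymptotics.IsBigO.of_bound (36 / Real.log 2) ?_
  filter_upwards [Filter.eventually_ge_atTop 2] with n hn
  have hn' : (0 : ℝ) < n := by positivity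
  have h1 : (1 : ℕ) ≤ Nat.log 2 n := Nat.log_pos one_lt_two hn
  have h1' : (1 : ℝ) ≤ Nat.log 2 n := by exact_mod_cast h1
  have h3 : (Nat.log 2 n : ℝ) * Real.log 2 ≤ Real.log n := by
    rw [← Real.log_pow]
    refine Real.log_le_log (by positivity) ?_
    exact_mod_cast Nat.pow_log_le_self 2 (by omega)
  have h4 : (0 : ℝ) ≤ Real.log n := Real.log_natCast_nonneg n
  rw [Real.norm_of_nonneg (by positivity), Real.norm_of_nonneg h4, div_mul_eq_mul_div,
    le_div_iff₀ h2]
  push_cast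
  nlinarith

end STAM

theorem theorem3 :
    ∃ f : ℕ → ℕ,
      (fun n : ℕ => (f n : ℝ)) =O[Filter.atTop] (fun n : ℕ => Real.log (n : ℝ)) ∧
      ∀ n : ℕ, 1 ≤ n →
        ∃ (Γ Λ : Type) (_ : Fintype Γ) (_ : DecidableEq Γ) (S : STAM.System Γ Λ),
          S.temperature = 1 ∧
          (∀ g : Γ, S.strength g = 1) ∧
          S.tiles.ncard = 4 ∧
          (∀ t ∈ S.tiles, t.glueCount ≤ f n) ∧
          (∀ t ∈ S.tiles, t.NoGlueDeactivation) ∧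
          S.UniquelyAssembles (STAM.line n) := by
  refine ⟨_, STAM.isBigO_natLog, fun n hn => ?_⟩
  have hm : n ≤ 2 ^ (Nat.log 2 n + 1) := (Nat.lt_pow_succ_log_self one_lt_two n).le
  exact ⟨STAM.LineGlue (Nat.log 2 n + 1), Unit, inferInstance, inferInstance,
    STAM.lineSystem n _, rfl, fun _ => rfl, STAM.lineSystem_ncard n _,
    fun t _ => STAM.glueCount_le t, fun t ht => STAM.lineSystem_noGlueDeactivation ht,
    STAM.lineSystem_uniquelyAssembles hn hm⟩
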